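/- Let $n\in\mathbb N$, let $T$ be a compact metric space, let $f:\mathbb R^n\to\mathbb R$ and $g_t:\mathbb R^n\to\mathbb R$ ($t\in T$) be convex functions such that $(t,x)\mapsto g_t(x)$ is continuous on $T\times\mathbb R^n$, and let $q>0$. For $(c,b)\in\mathbb R^n\times C(T,\mathbb R)$ consider the problem $$P(c,b):\quad \text{minimize } f(x)+\langle c,x\rangle \quad\text{subject to } g_t(x)\le b_t,\ t\in T,$$ let $\mathcal S(c,b)\subset\mathbb R^n$ be its set of solutions, and let $\mathcal S_c(b):=\mathcal S(c,b)$. Here $\mathbb R^n$ carries the Euclidean norm, $C(T,\mathbb R)$ the maximum norm $\|\cdot\|_\infty$, and $\mathbb R^n\times C(T,\mathbb R)$ the norm $\|(c,b)\|=\max\{\|c\|,\|b\|_\infty\}$. For a set-valued mapping $S:Y\rightrightarrows X$ between metric spaces and $\bar x\in S(\bar y)$, let $\mathrm{clm}_q S(\bar y,\bar x)\in[0,\infty]$ be the $q$-order calmness modulus of $S$ at $(\bar y,\bar x)$: the supremum of all $\tau>0$ for which there exist neighbourhoods $U$ of $\bar x$ and $V$ of $\bar y$ such that $$\tau\, d(x,S(\bar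 y))\le d(y,\bar y)^q\qquad\text{for all } y\in V \text{ and } x\in S(y)\cap U$$ (and $0$ if there is no such $\tau$). Let $\bar x\in\mathcal S(\bar c,\bar b)$ and suppose that the Extended Nürnberger Condition holds at $((\bar c,\bar b),\bar x)$, that is: there is $\hat x\in\mathbb R^n$ with $g_t(\hat x)<\bar b_t$ for all $t\in T$ (the Slater condition), and there is no set $D\subset\{t\in T: g_t(\bar x)=\bar b_t\}$ with $|D|<n$ such that $$-(\partial f(\bar x)+\bar c)\cap\mathrm{cone}\Big(\bigcup_{t\in D}\partial g_t(\bar x)\Big)\ne\emptyset,$$ where $\partial$ is the subdifferential of convex analysis and $\mathrm{cone}$ denotes the conical convex hull, with $0\in\mathrm{cone}(A)$ for every $A$ and $\mathrm{cone}(\emptyset)=\{0\}$. Then $$\mathrm{clm}_q\,\mathcal S\big((\bar c,\bar b),\bar x\big)=\mathrm{clm}_q\,\mathcal S_{\bar c}(\bar b,\bar x).$$ -/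

import Mathlib

open Set Topology
open scoped NNReal ENNReal

/-- The `q`-order calmness modulus of a set-valued mapping `S : Y ⇉ X` at `(ybar, xbar)`: the
supremum of all `τ > 0` for which there are neighbourhoods `U` of `xbar` and `V` of `ybar` with
`τ * d(x, S ybar) ≤ d(y, ybar) ^ q` for all `y ∈ V` and `x ∈ S y ∩ U`. It takes values in
`[0, ∞]`; it is `0` if there is no such `τ`. The distance to the empty set is `∞`. -/
noncomputable def calmnessModulus {Y X : Type*} [PseudoMetricSpace Y] [PseudoMetricSpace X]
    (q : ℝ) (S : Y → Set X) (ybar : Y) (xbar : X) : ℝ≥0∞ :=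
  sSup {t : ℝ≥0∞ | ∃ τ : ℝ≥0, 0 < τ ∧ t = (τ : ℝ≥0∞) ∧
    ∃ U ∈ 𝓝 xbar, ∃ V ∈ 𝓝 ybar, ∀ y ∈ V, ∀ x ∈ S y ∩ U,
      (τ : ℝ≥0∞) * Metric.infEDist x (S ybar) ≤ edist y ybar ^ q}

namespace ConvexSIP

/-- The subdifferential of convex analysis, with dual vectors represented by the inner product. -/
def subdifferential {n : ℕ} (h : EuclideanSpace ℝ (Fin n) → ℝ) (x : EuclideanSpace ℝ (Fin n)) :
    Set (EuclideanSpace ℝ (Fin n)) :=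
  {u | ∀ y, h x + inner ℝ u (y - x) ≤ h y}

variable {n : ℕ} {T : Type*} [TopologicalSpace T]

/-- The feasible set of `P(c, b)`: minimize `f x + ⟪c, x⟫` subject to `g t x ≤ b t`, `t ∈ T`. -/
def feasible (g : T → EuclideanSpace ℝ (Fin n) → ℝ) (b : C(T, ℝ)) :
    Set (EuclideanSpace ℝ (Fin n)) :=
  {x | ∀ t, g t x ≤ b t}

/-- The argmin mapping `(c, b) ↦ {x | x solves P(c, b)}` on the full parameter space. The norm of
the product `ℝⁿ × C(T, ℝ)` is `max ‖c‖ ‖b‖`, with the Euclidean and the maximum norm. -/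
def argmin (f : EuclideanSpace ℝ (Fin n) → ℝ) (g : T → EuclideanSpace ℝ (Fin n) → ℝ)
    (p : EuclideanSpace ℝ (Fin n) × C(T, ℝ)) : Set (EuclideanSpace ℝ (Fin n)) :=
  {x | x ∈ feasible g p.2 ∧ ∀ y ∈ feasible g p.2, f x + inner ℝ p.1 x ≤ f y + inner ℝ p.1 y}

/-- The partial argmin mapping `b ↦ argmin (c, b)`, with `c` fixed. -/
def partialArgmin (f : EuclideanSpace ℝ (Fin n) → ℝ) (g : T → EuclideanSpace ℝ (Fin n) → ℝ)
    (c : EuclideanSpace ℝ (Fin n)) (b : C(T, ℝ)) : Set (EuclideanSpace ℝ (Fin n)) :=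
  argmin f g (c, b)

/-- The indices of the constraints that are active at `x`. -/
def activeSet (g : T → EuclideanSpace ℝ (Fin n) → ℝ) (b : C(T, ℝ))
    (x : EuclideanSpace ℝ (Fin n)) : Set T :=
  {t | g t x = b t}

/-- The Slater condition. -/
def Slater (g : T → EuclideanSpace ℝ (Fin n) → ℝ) (b : C(T, ℝ)) : Prop :=
  ∃ x : EuclideanSpace ℝ (Fin n), ∀ t, g t x < b t

/-- The Extended Nürnberger Condition at `((c, b), x)`. The cone is the conical convex hull, which
always contains `0`. -/
def ENC (f : EuclideanSpace ℝ (Fin n) → ℝ) (g : T → EuclideanSpace ℝ (Fin n) → ℝ)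
    (c : EuclideanSpace ℝ (Fin n)) (b : C(T, ℝ)) (x : EuclideanSpace ℝ (Fin n)) : Prop :=
  Slater g b ∧
    ¬ ∃ D : Finset T, (D : Set T) ⊆ activeSet g b x ∧ D.card < n ∧
      ({v | ∃ u ∈ subdifferential f x, v = -(u + c)} ∩
        (PointedCone.hull ℝ (⋃ t ∈ D, subdifferential (g t) x) :
          Set (EuclideanSpace ℝ (Fin n)))).Nonempty

end ConvexSIP

/-!
The heart of the matter is that, under the Extended Nürnberger Condition, perturbing the linear term
adds nothing: for `(c, b)` near `(cbar, bbar)` and `x` near `xbar`, if `x` solves `P(c, b)` then `x`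
solves `P(cbar, b)` (`eventually_mem_partialArgmin`). Since `(cbar, b)` is no farther from
`(cbar, bbar)` than `(c, b)`, and both mappings have the same value at the reference parameter, every
constant admissible for one modulus is then admissible for the other.

To prove this inclusion, suppose it fails along an ultrafilter converging to the reference point.
The Slater condition persists, so each solution `x` of `P(c, b)` satisfies the Karush-Kuhn-Tucker
conditions `-(u + c) = ∑ i, w i • v i` with `n` subgradients `v i` of constraints
(`exists_isKKT_of_mem_argmin`, whose source is `zero_mem_convexHull_active_subgradients`). Indices
and subgradients stay in compact sets, multipliers are bounded by means of a Slater point, and all of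
them converge to Karush-Kuhn-Tucker data at `xbar`. There the Extended Nürnberger Condition and
Carathéodory's theorem for cones force the limits of the `v i` to be a basis of `ℝⁿ` and the limits
of the `w i` to be positive (`IsKKT.linearIndependent_and_pos`). Hence `-(u + c)` tends to an
interior point of the limiting cone, the coordinates of `-(u + cbar)` in the basis `v` are eventually
positive too (`exists_tendsto_coordinates`), and the same indices certify that `x` solves
`P(cbar, b)`.
-/

open Filter

namespace ConvexSIP

variable {n : ℕ}

/-! ### Subgradients of convex functions -/

/-- A finite convex function on `ℝⁿ` has a subgradient at every point: the strict epigraph is open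
and convex, and a hyperplane supporting it at `(x, h x)` cannot be vertical. -/
theorem subdifferential_nonempty {h : EuclideanSpace ℝ (Fin n) → ℝ} (hh : ConvexOn ℝ univ h)
    (x : EuclideanSpace ℝ (Fin n)) : (subdifferential h x).Nonempty := by
  have hcont : Continuous h := hh.locallyLipschitz.continuous
  have hopen : IsOpen {p : EuclideanSpace ℝ (Fin n) × ℝ | p.1 ∈ univ ∧ h p.1 < p.2} := by
    simpa using isOpen_lt (hcont.comp continuous_fst) continuous_snd
  obtain ⟨F, hF⟩ := geometric_hahn_banach_open_point (x := (x, h x)) hh.convex_strict_epigraph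
    hopen (by simp)
  have hsplit : ∀ y r, F (y, r) = F (y, 0) + r * F (0, 1) := fun y r ↦ by
    rw [← smul_eq_mul, ← map_smul, ← map_add]
    simp
  have hβ : F (0, 1) < 0 := by
    have := hF (x, h x + 1) ⟨mem_univ _, by simp⟩
    rw [hsplit, hsplit x (h x)] at this
    linarith
  have hle : ∀ y, F (y, 0) + h y * F (0, 1) ≤ F (x, 0) + h x * F (0, 1) := fun y ↦ by
    refine le_of_forall_pos_lt_add fun ε hε ↦ ?_
    have := hF (y, h y + ε / -F (0, 1)) ⟨mem_univ _, by
      simpa using div_pos hε (neg_pos.2 hβ)⟩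
    rw [hsplit, hsplit x (h x), add_mul, div_mul_eq_mul_div, mul_div_assoc, div_neg,
      div_self hβ.ne] at this
    linarith
  refine ⟨(InnerProductSpace.toDual ℝ _).symm
    ((-F (0, 1))⁻¹ • F.comp (ContinuousLinearMap.inl ℝ _ ℝ)), fun y ↦ ?_⟩
  have hsub : F (y - x, 0) = F (y, 0) - F (x, 0) := by
    rw [← map_sub]
    simp
  rw [InnerProductSpace.toDual_symm_apply]
  simp only [smul_apply, ContinuousLinearMap.comp_apply,
    ContinuousLinearMap.inl_apply, hsub, smul_eq_mul]
  rw [← le_sub_iff_add_le', inv_mul_le_iff₀ (neg_pos.2 hβ)]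
  linarith [hle y]

theorem convex_subdifferential (h : EuclideanSpace ℝ (Fin n) → ℝ) (x : EuclideanSpace ℝ (Fin n)) :
    Convex ℝ (subdifferential h x) := by
  intro u hu v hv a b ha hb hab y
  rw [inner_add_left, real_inner_smul_left, real_inner_smul_left]
  have h1 := mul_le_mul_of_nonneg_left (hu y) ha
  have h2 := mul_le_mul_of_nonneg_left (hv y) hb
  have h3 : a * h x + b * h x = h x := by rw [← add_mul, hab, one_mul]
  have h4 : a * h y + b * h y = h y := by rw [← add_mul, hab, one_mul]
  linarith

/-- A limit along an ultrafilter is available for any function with values eventually in a compact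
set. -/
theorem exists_tendsto_of_eventually_mem {X Y : Type*} [TopologicalSpace Y] (U : Ultrafilter X)
    {a : X → Y} {K : Set Y} (hK : IsCompact K) (ha : ∀ᶠ p in (U : Filter X), a p ∈ K) :
    ∃ y ∈ K, Tendsto a U (𝓝 y) :=
  hK.ultrafilter_le_nhds (U.map a) (le_principal_iff.2 ha)

section Family

variable {S : Type*} [TopologicalSpace S] [CompactSpace S]
  {h : S → EuclideanSpace ℝ (Fin n) → ℝ}

/-- The subgradients of a jointly continuous compact family are bounded near any point, uniformly
in the index. -/
theorem exists_norm_subgradient_le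
    (hc : Continuous fun p : S × EuclideanSpace ℝ (Fin n) ↦ h p.1 p.2)
    (x : EuclideanSpace ℝ (Fin n)) :
    ∃ M, ∀ s, ∀ y ∈ Metric.ball x 1, ∀ v ∈ subdifferential (h s) y, ‖v‖ ≤ M := by
  obtain ⟨M, hM⟩ := ((isCompact_univ (X := S)).prod
    (isCompact_closedBall x 2)).exists_bound_of_continuousOn hc.continuousOn
  have hM' : ∀ s, ∀ y ∈ Metric.closedBall x 2, |h s y| ≤ M := fun s y hy ↦
    hM (s, y) ⟨mem_univ _, hy⟩
  refine ⟨2 * M, fun s y hy v hv ↦ ?_⟩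
  rw [Metric.mem_ball, dist_eq_norm] at hy
  have hM0 : 0 ≤ M := (abs_nonneg _).trans (hM' s x (Metric.mem_closedBall_self zero_le_two))
  rcases eq_or_ne v 0 with rfl | hv0
  · simpa using hM0
  have hvpos : 0 < ‖v‖ := norm_pos_iff.2 hv0
  have h1 := hv (y + ‖v‖⁻¹ • v)
  rw [add_sub_cancel_left, real_inner_smul_right, real_inner_self_eq_norm_sq, sq,
    inv_mul_cancel_left₀ hvpos.ne'] at h1
  have h2 := abs_le.1 (hM' s y (by rw [Metric.mem_closedBall, dist_eq_norm]; linarith))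
  have h3 := abs_le.1 (hM' s (y + ‖v‖⁻¹ • v) (by
    rw [Metric.mem_closedBall, dist_eq_norm, add_sub_right_comm]
    refine (norm_add_le _ _).trans ?_
    rw [norm_smul, norm_inv, norm_norm, inv_mul_cancel₀ hvpos.ne']
    linarith))
  linarith [h2.1, h3.2]

/-- Closedness and local compactness of the subgradient map of a compact family: indices and
subgradients at points tending to `x` converge along an ultrafilter, and the limit is a
subgradient at `x`. -/
theorem exists_tendsto_subgradient
    (hc : Continuous fun p : S × EuclideanSpace ℝ (Fin n) ↦ h p.1 p.2)
    {X : Type*} (U : Ultrafilter X) {s : X → S} {y v : X → EuclideanSpace ℝ (Fin n)}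
    {x : EuclideanSpace ℝ (Fin n)} (hy : Tendsto y U (𝓝 x))
    (hv : ∀ᶠ p in (U : Filter X), v p ∈ subdifferential (h (s p)) (y p)) :
    ∃ s₀, ∃ v₀ ∈ subdifferential (h s₀) x, Tendsto s U (𝓝 s₀) ∧ Tendsto v U (𝓝 v₀) := by
  obtain ⟨s₀, -, hs₀⟩ := exists_tendsto_of_eventually_mem U (a := s) isCompact_univ (by simp)
  obtain ⟨M, hM⟩ := exists_norm_subgradient_le hc x
  obtain ⟨v₀, -, hv₀⟩ := exists_tendsto_of_eventually_mem U (a := v)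
    (isCompact_closedBall 0 M) (by
      filter_upwards [hv, hy (Metric.ball_mem_nhds x one_pos)] with p hp hp'
      simpa using hM _ _ hp' _ hp)
  refine ⟨s₀, v₀, fun z ↦ ?_, hs₀, hv₀⟩
  have h1 : Tendsto (fun p ↦ h (s p) (y p)) U (𝓝 (h s₀ x)) :=
    (hc.tendsto (s₀, x)).comp (hs₀.prodMk_nhds hy)
  have h2 : Tendsto (fun p ↦ h (s p) z) U (𝓝 (h s₀ z)) :=
    (hc.tendsto (s₀, z)).comp (hs₀.prodMk_nhds tendsto_const_nhds)
  exact le_of_tendsto_of_tendsto (h1.add (hv₀.inner (tendsto_const_nhds.sub hy))) h2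
    (hv.mono fun p hp ↦ hp z)

end Family

/-! ### Finite nonnegative combinations -/

/-- A weighted family indexed by a type with at most `N` elements can be reindexed by `Fin N`,
the missing indices receiving the weight `0` and a prescribed value. -/
theorem exists_fin_extension {ι α : Type*} [Fintype ι] {N : ℕ} (hN : Fintype.card ι ≤ N)
    (a : ι → α) (w : ι → ℝ) (a₀ : α) :
    ∃ (a' : Fin N → α) (w' : Fin N → ℝ),
      (∀ i, (∃ j, a' i = a j ∧ w' i = w j) ∨ (a' i = a₀ ∧ w' i = 0)) ∧
      (∑ i, w' i = ∑ j, w j) ∧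
      ∀ F : α → EuclideanSpace ℝ (Fin n), ∑ i, w' i • F (a' i) = ∑ j, w j • F (a j) := by
  obtain ⟨e⟩ : Nonempty (ι ↪ Fin N) :=
    Function.Embedding.nonempty_of_card_le (by simpa using hN)
  have hw : ∀ i ∉ range e, Function.extend e w 0 i = 0 := fun i hi ↦ by
    rw [Function.extend_apply' _ _ _ hi]; rfl
  refine ⟨Function.extend e a fun _ ↦ a₀, Function.extend e w 0, fun i ↦ ?_, ?_, fun F ↦ ?_⟩
  · by_cases hi : i ∈ range e
    · obtain ⟨j, rfl⟩ := hi
      exact Or.inl ⟨j, by rw [e.injective.extend_apply], by rw [e.injective.extend_apply]⟩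
    · exact Or.inr ⟨by rw [Function.extend_apply' _ _ _ hi], hw i hi⟩
  · refine (Fintype.sum_of_injective e e.injective _ _ hw fun j ↦ ?_).symm
    rw [e.injective.extend_apply]
  · refine (Fintype.sum_of_injective e e.injective _ _ (fun i hi ↦ ?_) fun j ↦ ?_).symm
    · rw [hw i hi, zero_smul]
    · rw [e.injective.extend_apply, e.injective.extend_apply]

/-- The convex hull of a compact subset of `ℝⁿ` is compact: by Carathéodory's theorem it is the
image of a compact set of combinations of `n + 1` points. -/
theorem isCompact_convexHull {K : Set (EuclideanSpace ℝ (Fin n))} (hK : IsCompact K) :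
    IsCompact (convexHull ℝ K) := by
  rcases K.eq_empty_or_nonempty with rfl | ⟨k, hk⟩
  · simp
  have hcomp : IsCompact (stdSimplex ℝ (Fin (n + 1)) ×ˢ (univ.pi fun _ : Fin (n + 1) ↦ K)) :=
    (isCompact_stdSimplex ℝ _).prod (isCompact_univ_pi fun _ ↦ hK)
  have himage := hcomp.image (f := fun p : (Fin (n + 1) → ℝ) × (Fin (n + 1) →
    EuclideanSpace ℝ (Fin n)) ↦ ∑ i, p.1 i • p.2 i) (by fun_prop)
  convert! himage using 1
  refine Subset.antisymm (fun x hx ↦ ?_) ?_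
  · obtain ⟨ι, _, z, w, hz, hind, hw, hw1, rfl⟩ := eq_pos_convex_span_of_mem_convexHull hx
    have hcard : Fintype.card ι ≤ n + 1 := by
      refine hind.card_le_finrank_succ.trans (Nat.succ_le_succ ?_)
      exact (Submodule.finrank_le _).trans (by simp)
    obtain ⟨z', w', hzw, hsum, hF⟩ := exists_fin_extension (n := n) hcard z w k
    refine ⟨(w', z'), ⟨⟨fun i ↦ ?_, hsum.trans hw1⟩, fun i _ ↦ ?_⟩, hF id⟩
    · rcases hzw i with ⟨j, -, h⟩ | ⟨-, h⟩
      · exact (hw j).le.trans_eq h.symm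
      · exact h.ge
    · rcases hzw i with ⟨j, h, -⟩ | ⟨h, -⟩
      · exact mem_of_eq_of_mem h (hz (mem_range_self j))
      · exact mem_of_eq_of_mem h hk
  · rintro _ ⟨⟨w, z⟩, ⟨⟨hw0, hw1⟩, hz⟩, rfl⟩
    exact (convex_convexHull ℝ K).sum_mem (fun i _ ↦ hw0 i) hw1
      fun i _ ↦ subset_convexHull ℝ K (hz i (mem_univ i))

/-- Carathéodory's theorem for cones: a nonnegative combination can be rewritten with weights
supported on linearly independent members of the family, inside the original support. -/
theorem exists_linearIndependent_support {ι V : Type*} [Fintype ι] [AddCommGroup V] [Module ℝ V]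
    (v : ι → V) (w : ι → ℝ) (hw : ∀ i, 0 ≤ w i) :
    ∃ w' : ι → ℝ, (∀ i, 0 ≤ w' i) ∧ (∀ i, w i = 0 → w' i = 0) ∧
      ∑ i, w' i • v i = ∑ i, w i • v i ∧
      LinearIndependent ℝ fun i : {i // w' i ≠ 0} ↦ v i := by
  classical
  induction hk : (Finset.univ.filter fun i ↦ w i ≠ 0).card using Nat.strong_induction_on
    generalizing w with
  | _ k ih =>
  by_cases hli : LinearIndependent ℝ fun i : {i // w i ≠ 0} ↦ v i
  · exact ⟨w, hw, fun _ h ↦ h, rfl, hli⟩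
  obtain ⟨a', ha', i₁, hi₁⟩ := Fintype.not_linearIndependent_iff.1 hli
  -- Extend the relation by zero, with the sign chosen so that some coefficient is positive.
  obtain ⟨a, hasupp, ha, i₂, hi₂⟩ : ∃ a : ι → ℝ, (∀ i, w i = 0 → a i = 0) ∧
      ∑ i, a i • v i = 0 ∧ ∃ i, 0 < a i := by
    let b : ι → ℝ := fun i ↦ if h : w i ≠ 0 then a' ⟨i, h⟩ else 0
    have hb : ∀ i, w i = 0 → b i = 0 := fun i hi ↦ by simp [b, hi]
    have hbs : ∑ i, b i • v i = 0 := by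
      rw [← ha']
      refine (Fintype.sum_of_injective Subtype.val Subtype.val_injective _ _ ?_ ?_).symm
      · intro i hi
        rw [hb i (by simpa using hi), zero_smul]
      · intro i
        simp [b, i.2]
    have hb1 : b i₁ ≠ 0 := by simpa [b, i₁.2] using hi₁
    rcases hb1.lt_or_gt with h | h
    · refine ⟨-b, fun i hi ↦ by simp [hb i hi], ?_, i₁, by simpa using h⟩
      simp [hbs]
    · exact ⟨b, hb, hbs, i₁, h⟩
  obtain ⟨i₀, hi₀, hmin⟩ := (Finset.univ.filter fun i ↦ 0 < a i).exists_min_image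
    (fun i ↦ w i / a i) ⟨i₂, by simpa using hi₂⟩
  simp only [Finset.mem_filter, Finset.mem_univ, true_and] at hi₀ hmin
  set ρ := w i₀ / a i₀ with hρ
  have hρ0 : 0 ≤ ρ := div_nonneg (hw _) hi₀.le
  have hwne : w i₀ ≠ 0 := fun h ↦ hi₀.ne' (hasupp _ h)
  have hnew0 : ∀ i, w i = 0 → w i - ρ * a i = 0 := fun i hi ↦ by simp [hi, hasupp i hi]
  obtain ⟨w', h1, h2, h3, h4⟩ := ih _ (by
    rw [← hk]
    refine Finset.card_lt_card (Finset.ssubset_iff_of_subset ?_ |>.2 ⟨i₀, ?_, ?_⟩)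
    · intro i hi
      simp only [Finset.mem_filter, Finset.mem_univ, true_and] at hi ⊢
      exact fun h ↦ hi (hnew0 i h)
    · simpa using hwne
    · simp [hρ, div_mul_cancel₀ _ hi₀.ne']) (fun i ↦ w i - ρ * a i) (fun i ↦ by
      rcases lt_or_ge 0 (a i) with h | h
      · have := (le_div_iff₀ h).1 (hmin i h)
        simpa using this
      · have := mul_nonpos_of_nonneg_of_nonpos hρ0 h
        have := hw i
        linarith) rfl
  refine ⟨w', h1, fun i hi ↦ h2 i (hnew0 i hi), h3.trans ?_, h4⟩
  simp only [sub_smul, mul_smul, Finset.sum_sub_distrib, ← Finset.smul_sum, ha, smul_zero, sub_zero]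

/-! ### Optimality conditions -/

/-- If `x` minimizes the supremum of a compact, jointly continuous family of convex functions, with
minimal value `0`, then `0` is a convex combination of subgradients at `x` of active members.
Otherwise some direction `d` is strictly separated from all these subgradients; subgradients of
members that are nonnegative at `x + r • d` make no negative product with `d`, and as `r` tends to
`0` they accumulate at a subgradient of an active member. -/
theorem zero_mem_convexHull_active_subgradients {S : Type*} [TopologicalSpace S] [CompactSpace S]
    {h : S → EuclideanSpace ℝ (Fin n) → ℝ} (hh : ∀ s, ConvexOn ℝ univ (h s))
    (hc : Continuous fun p : S × EuclideanSpace ℝ (Fin n) ↦ h p.1 p.2)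
    {x : EuclideanSpace ℝ (Fin n)} (hx : ∀ s, h s x ≤ 0) (hsup : ∀ y, ∃ s, 0 ≤ h s y) :
    (0 : EuclideanSpace ℝ (Fin n)) ∈
      convexHull ℝ {v | ∃ s, h s x = 0 ∧ v ∈ subdifferential (h s) x} := by
  set K := {v | ∃ s, h s x = 0 ∧ v ∈ subdifferential (h s) x}
  have hcx : Continuous fun s ↦ h s x := hc.comp (continuous_id.prodMk continuous_const)
  have hK : IsCompact K := by
    refine isCompact_iff_ultrafilter_le_nhds.2 fun U hU ↦ ?_
    have hU' : ∀ᶠ v in (U : Filter (EuclideanSpace ℝ (Fin n))), ∃ s,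
      h s x = 0 ∧ v ∈ subdifferential (h s) x := le_principal_iff.1 hU
    obtain ⟨s, hs⟩ := hU'.choice
    obtain ⟨s₀, v₀, hv₀, hs₀, hlim⟩ := exists_tendsto_subgradient hc U (s := s)
      (y := fun _ ↦ x) (v := id) tendsto_const_nhds (hs.mono fun _ h ↦ h.2)
    refine ⟨v₀, ⟨s₀, ?_, hv₀⟩, hlim⟩
    exact tendsto_nhds_unique (((hcx.tendsto s₀).comp hs₀))
      (tendsto_const_nhds.congr' (hs.mono fun _ h ↦ h.1.symm))
  by_contra h0
  obtain ⟨l, u, hlu, hl⟩ := geometric_hahn_banach_point_closed (convex_convexHull ℝ K)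
    (isCompact_convexHull hK).isClosed h0
  rw [map_zero] at hlu
  set d := -(InnerProductSpace.toDual ℝ _).symm l
  have hd : ∀ v, inner ℝ v d = -l v := fun v ↦ by
    rw [inner_neg_right, real_inner_comm, InnerProductSpace.toDual_symm_apply]
  choose s hs using fun r : ℝ ↦ hsup (x + r • d)
  choose v hv using fun r : ℝ ↦ subdifferential_nonempty (hh (s r)) (x + r • d)
  let U : Ultrafilter ℝ := Ultrafilter.of (𝓝[>] 0)
  have hU : (U : Filter ℝ) ≤ 𝓝[>] 0 := Ultrafilter.of_le _
  have hy : Tendsto (fun r : ℝ ↦ x + r • d) U (𝓝 x) := by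
    have : Continuous fun r : ℝ ↦ x + r • d := by fun_prop
    simpa using (this.tendsto 0).mono_left (hU.trans nhdsWithin_le_nhds)
  obtain ⟨s₀, v₀, hv₀, hs₀, hlim⟩ := exists_tendsto_subgradient hc U hy (Eventually.of_forall hv)
  have hact : h s₀ x = 0 := le_antisymm (hx s₀) <|
    ge_of_tendsto' ((hc.tendsto (s₀, x)).comp (hs₀.prodMk_nhds hy)) hs
  have hpos : 0 ≤ inner ℝ v₀ d := by
    refine ge_of_tendsto (hlim.inner tendsto_const_nhds) ?_
    filter_upwards [hU self_mem_nhdsWithin] with r hr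
    have h1 := hv r x
    rw [sub_add_cancel_left, inner_neg_right, real_inner_smul_right] at h1
    have h2 : 0 ≤ r * inner ℝ (v r) d := by linarith [hs r, hx (s r)]
    exact nonneg_of_mul_nonneg_right h2 hr
  have := hl v₀ (subset_convexHull ℝ K ⟨s₀, hact, hv₀⟩)
  rw [hd] at hpos
  linarith

section Multipliers

variable {T : Type*} [TopologicalSpace T]
  {f : EuclideanSpace ℝ (Fin n) → ℝ} {g : T → EuclideanSpace ℝ (Fin n) → ℝ}
  {c : EuclideanSpace ℝ (Fin n)} {b : C(T, ℝ)} {x : EuclideanSpace ℝ (Fin n)}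

/-- The Karush-Kuhn-Tucker conditions at `x` for `P(c, b)` with `n` multipliers `w i` attached to
indices `t i` and subgradients `v i`. Inactive indices are allowed, with multiplier `0`. -/
structure IsKKT (f : EuclideanSpace ℝ (Fin n) → ℝ) (g : T → EuclideanSpace ℝ (Fin n) → ℝ)
    (c : EuclideanSpace ℝ (Fin n)) (b : C(T, ℝ)) (x u : EuclideanSpace ℝ (Fin n))
    (t : Fin n → T) (v : Fin n → EuclideanSpace ℝ (Fin n)) (w : Fin n → ℝ) : Prop where
  objective : u ∈ subdifferential f x
  constraint : ∀ i, v i ∈ subdifferential (g (t i)) x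
  nonneg : ∀ i, 0 ≤ w i
  complementary : ∀ i, w i * (g (t i) x - b (t i)) = 0
  stationary : ∑ i, w i • v i = -(u + c)

/-- The objective gap from `x` to any `y` dominates the weighted slacks at `y`. For feasible `y` this
gives optimality of `x`; for a Slater point it bounds the multipliers. -/
theorem IsKKT.sum_mul_sub_le {u : EuclideanSpace ℝ (Fin n)} {t : Fin n → T}
    {v : Fin n → EuclideanSpace ℝ (Fin n)} {w : Fin n → ℝ} (hk : IsKKT f g c b x u t v w)
    (y : EuclideanSpace ℝ (Fin n)) :
    ∑ i, w i * (b (t i) - g (t i) y) ≤ f y + inner ℝ c y - (f x + inner ℝ c x) := by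
  have h1 : ∑ i, w i * (b (t i) - g (t i) y) ≤ ∑ i, -inner ℝ (w i • v i) (y - x) := by
    refine Finset.sum_le_sum fun i _ ↦ ?_
    rw [real_inner_smul_left]
    have := mul_le_mul_of_nonneg_left (hk.constraint i y) (hk.nonneg i)
    have := hk.complementary i
    linarith
  rw [Finset.sum_neg_distrib, ← sum_inner, hk.stationary, inner_neg_left, neg_neg,
    inner_add_left, inner_sub_right c] at h1
  have := hk.objective y
  linarith

theorem IsKKT.mem_argmin {u : EuclideanSpace ℝ (Fin n)} {t : Fin n → T}
    {v : Fin n → EuclideanSpace ℝ (Fin n)} {w : Fin n → ℝ} (hk : IsKKT f g c b x u t v w)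
    (hx : x ∈ feasible g b) : x ∈ argmin f g (c, b) := by
  refine ⟨hx, fun y hy ↦ ?_⟩
  have := hk.sum_mul_sub_le y
  have : 0 ≤ ∑ i, w i * (b (t i) - g (t i) y) :=
    Finset.sum_nonneg fun i _ ↦ mul_nonneg (hk.nonneg i) (sub_nonneg.2 (hy (t i)))
  simp only
  linarith

/-- At a solution, either `0` is a subgradient of the objective or a subgradient of the objective is
balanced by a nonnegative multiple of a convex combination of active constraint subgradients: under
the Slater condition the objective has positive weight in the convex combination representing
`0`. -/
theorem exists_smul_mem_convexHull_of_mem_argmin [CompactSpace T] (hf : ConvexOn ℝ univ f)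
    (hg : ∀ t, ConvexOn ℝ univ (g t))
    (hgc : Continuous fun p : T × EuclideanSpace ℝ (Fin n) ↦ g p.1 p.2)
    (hx : x ∈ argmin f g (c, b)) (hs : Slater g b) :
    ∃ u ∈ subdifferential f x, u + c = 0 ∨ ∃ r : ℝ, 0 ≤ r ∧
      ∃ z ∈ convexHull ℝ {v | ∃ t, g t x = b t ∧ v ∈ subdifferential (g t) x},
        r • z = -(u + c) := by
  let h : T ⊕ Unit → EuclideanSpace ℝ (Fin n) → ℝ := Sum.elim (fun t y ↦ g t y - b t)
    fun _ y ↦ f y + inner ℝ c y - (f x + inner ℝ c x)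
  have hh : ∀ s, ConvexOn ℝ univ (h s) := by
    rintro (t | _)
    · exact (hg t).sub (concaveOn_const _ convex_univ)
    · exact (hf.add ((innerₛₗ ℝ c).convexOn convex_univ)).sub (concaveOn_const _ convex_univ)
  have hc : Continuous fun p : (T ⊕ Unit) × EuclideanSpace ℝ (Fin n) ↦ h p.1 p.2 := by
    have hfc : Continuous f := hf.locallyLipschitz.continuous
    have : Continuous (Sum.elim
        (fun p : T × EuclideanSpace ℝ (Fin n) ↦ g p.1 p.2 - b p.1)
        fun p : Unit × EuclideanSpace ℝ (Fin n) ↦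
          f p.2 + inner ℝ c p.2 - (f x + inner ℝ c x)) := by
      refine continuous_sumElim.2 ⟨hgc.sub (by fun_prop), by fun_prop⟩
    convert! this.comp (Homeomorph.sumProdDistrib (X := T) (Y := Unit)
      (Z := EuclideanSpace ℝ (Fin n))).continuous using 1
    ext ⟨t | _, y⟩ <;> rfl
  have h0 := zero_mem_convexHull_active_subgradients hh hc (x := x)
    (by
      rintro (t | _)
      · exact sub_nonpos.2 (hx.1 t)
      · exact (sub_self _).le)
    (fun y ↦ by
      by_contra! hneg
      have := hx.2 y fun t ↦ (sub_neg.1 (hneg (Sum.inl t))).le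
      exact this.not_gt (sub_neg.1 (hneg (Sum.inr ()))))
  set K := {v | ∃ t, g t x = b t ∧ v ∈ subdifferential (g t) x}
  set K₀ := {v | v - c ∈ subdifferential f x}
  have hsub : {v | ∃ s, h s x = 0 ∧ v ∈ subdifferential (h s) x} ⊆ K₀ ∪ K := by
    rintro v ⟨t | _, h1, h2⟩
    · refine Or.inr ⟨t, sub_eq_zero.1 h1, fun y ↦ ?_⟩
      have h3 : g t x - b t + inner ℝ v (y - x) ≤ g t y - b t := h2 y
      linarith
    · refine Or.inl fun y ↦ ?_
      have h3 : f x + inner ℝ c x - (f x + inner ℝ c x) + inner ℝ v (y - x) ≤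
        f y + inner ℝ c y - (f x + inner ℝ c x) := h2 y
      rw [inner_sub_left, inner_sub_right c]
      linarith
  have hK₀ : Convex ℝ K₀ := by
    have : K₀ = (fun v ↦ v + -c) ⁻¹' subdifferential f x := by
      ext v
      simp [K₀, sub_eq_add_neg]
    rw [this]
    exact (convex_subdifferential f x).translate_preimage_left _
  obtain ⟨u₀, hu₀⟩ := subdifferential_nonempty hf x
  have hK₀ne : K₀.Nonempty := ⟨u₀ + c, by simpa [K₀] using hu₀⟩
  replace h0 := convexHull_mono hsub h0
  rcases K.eq_empty_or_nonempty with hK | hK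
  · rw [hK, union_empty, hK₀.convexHull_eq] at h0
    exact ⟨0 - c, h0, Or.inl (by simp)⟩
  rw [convexHull_union hK₀ne hK, hK₀.convexHull_eq, mem_convexJoin] at h0
  obtain ⟨a, ha, z, hz, α, β, hα, hβ, hαβ, hsum⟩ := h0
  obtain ⟨xs, hxs⟩ := hs
  -- Active subgradients, hence their convex combinations, point away from a Slater point.
  have hneg : inner ℝ z (xs - x) < 0 := by
    have hconv : Convex ℝ {v : EuclideanSpace ℝ (Fin n) | inner ℝ v (xs - x) < 0} := by
      have := convex_halfSpace_lt (innerₛₗ ℝ (xs - x)).isLinear (0 : ℝ)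
      simpa only [innerₛₗ_apply_apply, real_inner_comm] using this
    refine convexHull_min ?_ hconv hz
    rintro v ⟨t, ht, hv⟩
    have := hv xs
    have := hxs t
    simp only [mem_ofPred_eq]
    linarith
  have hα0 : α ≠ 0 := by
    rintro rfl
    rw [zero_add] at hαβ
    rw [hαβ, zero_smul, zero_add, one_smul] at hsum
    simp [hsum] at hneg
  refine ⟨a - c, ha, Or.inr ⟨α⁻¹ * β, by positivity, z, hz, ?_⟩⟩
  rw [sub_add_cancel, mul_smul, eq_neg_of_add_eq_zero_right hsum, smul_neg,
    inv_smul_smul₀ hα0]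

/-- Necessity of the Karush-Kuhn-Tucker conditions under the Slater condition, with at most `n`
constraints. -/
theorem exists_isKKT_of_mem_argmin [CompactSpace T] [Nonempty T] (hf : ConvexOn ℝ univ f)
    (hg : ∀ t, ConvexOn ℝ univ (g t))
    (hgc : Continuous fun p : T × EuclideanSpace ℝ (Fin n) ↦ g p.1 p.2)
    (hx : x ∈ argmin f g (c, b)) (hs : Slater g b) :
    ∃ u t v w, IsKKT f g c b x u t v w := by
  let t₀ : T := Classical.arbitrary T
  obtain ⟨v₀, hv₀⟩ := subdifferential_nonempty (hg t₀) x
  obtain ⟨u, hu, h0 | ⟨r, hr, z, hz, hrz⟩⟩ :=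
    exists_smul_mem_convexHull_of_mem_argmin hf hg hgc hx hs
  · exact ⟨u, fun _ ↦ t₀, fun _ ↦ v₀, 0, hu, fun _ ↦ hv₀, fun _ ↦ le_rfl, fun _ ↦ by simp,
      by simp [h0]⟩
  obtain ⟨ι, _, v, w, hv, -, hw, -, rfl⟩ := eq_pos_convex_span_of_mem_convexHull hz
  choose t ht hvt using fun j ↦ hv (mem_range_self j)
  obtain ⟨w', hw'0, -, hw's, hli⟩ := exists_linearIndependent_support v (fun j ↦ r * w j)
    fun j ↦ mul_nonneg hr (hw j).le
  have hcard : Fintype.card {j // w' j ≠ 0} ≤ n := by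
    simpa using hli.fintype_card_le_finrank
  obtain ⟨a, w'', haw, -, hF⟩ := exists_fin_extension (n := n) hcard
    (fun j ↦ (t j, v j)) (fun j ↦ w' j) (t₀, v₀)
  refine ⟨u, fun i ↦ (a i).1, fun i ↦ (a i).2, w'', hu, fun i ↦ ?_, fun i ↦ ?_, fun i ↦ ?_, ?_⟩
  · rcases haw i with ⟨j, h, -⟩ | ⟨h, -⟩
    · simpa [h] using hvt j
    · simpa [h] using hv₀
  · rcases haw i with ⟨j, -, h⟩ | ⟨-, h⟩
    · exact (hw'0 j).trans_eq h.symm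
    · exact h.ge
  · rcases haw i with ⟨j, h, -⟩ | ⟨-, h⟩
    · simp [h, ht]
    · simp [h]
  · rw [hF Prod.snd, ← hrz, Finset.smul_sum]
    simp only [← mul_smul]
    rw [← hw's]
    refine Fintype.sum_of_injective Subtype.val Subtype.val_injective _ _ ?_ fun _ ↦ rfl
    intro j hj
    have : w' j = 0 := by simpa using hj
    rw [this, zero_smul]

/-- Under the Extended Nürnberger Condition, Karush-Kuhn-Tucker multipliers are all
positive and belong to linearly independent subgradients, since otherwise Carathéodory's theorem
would leave fewer than `n` active constraints. -/
theorem IsKKT.linearIndependent_and_pos {u : EuclideanSpace ℝ (Fin n)} {t : Fin n → T}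
    {v : Fin n → EuclideanSpace ℝ (Fin n)} {w : Fin n → ℝ} (hk : IsKKT f g c b x u t v w)
    (hENC : ENC f g c b x) : LinearIndependent ℝ v ∧ ∀ i, 0 < w i := by
  classical
  obtain ⟨w', hw'0, hsupp, hsum, hli⟩ := exists_linearIndependent_support v w hk.nonneg
  set I := Finset.univ.filter fun i ↦ w' i ≠ 0
  have hI : ∀ i, w' i ≠ 0 := by
    by_contra! hex
    obtain ⟨i₀, hi₀⟩ := hex
    refine hENC.2 ⟨I.image t, fun s hs ↦ ?_, ?_, -(u + c), ⟨u, hk.objective, rfl⟩, ?_⟩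
    · simp only [Finset.coe_image, mem_image, I, Finset.coe_filter, Finset.mem_univ, true_and,
        mem_ofPred_eq] at hs
      obtain ⟨i, hi, rfl⟩ := hs
      have := (mul_eq_zero.1 (hk.complementary i)).resolve_left fun h ↦ hi (hsupp i h)
      exact sub_eq_zero.1 this
    · refine Finset.card_image_le.trans_lt ?_
      have : I ⊂ Finset.univ := Finset.ssubset_univ_iff.2 fun h ↦ by
        have : i₀ ∈ I := h ▸ Finset.mem_univ i₀
        simp [I, hi₀] at this
      simpa using Finset.card_lt_card this
    · rw [← hk.stationary, ← hsum]
      refine Submodule.sum_mem _ fun i _ ↦ ?_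
      by_cases hi : w' i = 0
      · rw [hi, zero_smul]
        exact Submodule.zero_mem _
      · refine Submodule.smul_mem (PointedCone.hull ℝ _) (⟨w' i, hw'0 i⟩ : {r : ℝ // 0 ≤ r}) ?_
        refine Submodule.subset_span (mem_iUnion₂.2 ⟨t i, ?_, hk.constraint i⟩)
        exact Finset.mem_image_of_mem t (by simpa [I] using hi)
  refine ⟨?_, fun i ↦ (hk.nonneg i).lt_of_ne' fun h ↦ hI i (hsupp i h)⟩
  exact hli.comp (fun i ↦ ⟨i, hI i⟩) fun i j h ↦ congrArg Subtype.val h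

end Multipliers

/-! ### Stability of the multipliers -/

/-- Coordinates with respect to a basis of `ℝⁿ` depend continuously on the basis and the vector:
if `v₀` is linearly independent and `v`, `z` converge to `v₀` and `∑ i, w₀ i • v₀ i`, then `z` is
eventually a combination of the `v i` with coefficients converging to `w₀`. -/
theorem exists_tendsto_coordinates {X : Type*} {l : Filter X}
    {v : X → Fin n → EuclideanSpace ℝ (Fin n)} {v₀ : Fin n → EuclideanSpace ℝ (Fin n)}
    {z : X → EuclideanSpace ℝ (Fin n)} {w₀ : Fin n → ℝ} (hli : LinearIndependent ℝ v₀)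
    (hv : ∀ i, Tendsto (fun p ↦ v p i) l (𝓝 (v₀ i)))
    (hz : Tendsto z l (𝓝 (∑ i, w₀ i • v₀ i))) :
    ∃ w : X → Fin n → ℝ, Tendsto w l (𝓝 w₀) ∧ ∀ᶠ p in l, ∑ i, w p i • v p i = z p := by
  let M : X → Matrix (Fin n) (Fin n) ℝ := fun p ↦ .of fun i j ↦ v p i j
  let M₀ : Matrix (Fin n) (Fin n) ℝ := .of fun i j ↦ v₀ i j
  have hM : Tendsto M l (𝓝 M₀) := by
    refine tendsto_pi_nhds.2 fun i ↦ tendsto_pi_nhds.2 fun j ↦ ?_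
    exact ((PiLp.continuous_apply 2 _ j).tendsto _).comp (hv i)
  have hdet₀ : M₀.det ≠ 0 := by
    have : LinearIndependent ℝ M₀.row := hli.map' (WithLp.linearEquiv 2 ℝ (Fin n → ℝ)).toLinearMap
      (LinearEquiv.ker _)
    exact ((Matrix.isUnit_iff_isUnit_det _).1
      (Matrix.linearIndependent_rows_iff_isUnit.1 this)).ne_zero
  have hdet : Tendsto (fun p ↦ (M p).det) l (𝓝 M₀.det) :=
    ((Continuous.matrix_det continuous_id).tendsto M₀).comp hM
  have hinv : Tendsto (fun p ↦ (M p)⁻¹) l (𝓝 M₀⁻¹) := by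
    simp only [Matrix.inv_def, Ring.inverse_eq_inv']
    exact (hdet.inv₀ hdet₀).smul (((Continuous.matrix_adjugate continuous_id).tendsto M₀).comp hM)
  -- Combinations of the rows are products of row vectors with the matrix.
  have hcomb : ∀ (a : Fin n → ℝ) (y : Fin n → EuclideanSpace ℝ (Fin n)),
      (WithLp.ofLp (∑ i, a i • y i) : Fin n → ℝ) =
        Matrix.vecMul a (.of fun i j ↦ y i j) := fun a y ↦ by
    ext j
    simp [Matrix.vecMul, dotProduct]
  refine ⟨fun p ↦ Matrix.vecMul (WithLp.ofLp (z p)) (M p)⁻¹, ?_, ?_⟩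
  · have hz' : Tendsto (fun p ↦ WithLp.ofLp (z p)) l (𝓝 (Matrix.vecMul w₀ M₀)) := by
      rw [← hcomb]
      exact ((PiLp.continuous_ofLp 2 _).tendsto _).comp hz
    have hcont : Continuous fun q : (Fin n → ℝ) × Matrix (Fin n) (Fin n) ℝ ↦
        Matrix.vecMul q.1 q.2 := continuous_fst.matrix_vecMul continuous_snd
    have := (hcont.tendsto (Matrix.vecMul w₀ M₀, M₀⁻¹)).comp (hz'.prodMk_nhds hinv)
    simpa only [Matrix.vecMul_vecMul, Matrix.mul_nonsing_inv _ hdet₀.isUnit, Matrix.vecMul_one,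
      Function.comp_def] using this
  · filter_upwards [hdet.eventually_ne hdet₀] with p hp
    refine WithLp.ofLp_injective 2 ?_
    rw [hcomb, Matrix.vecMul_vecMul]
    change Matrix.vecMul _ ((M p)⁻¹ * M p) = _
    rw [Matrix.nonsing_inv_mul _ hp.isUnit, Matrix.vecMul_one]

variable {T : Type*}

/-- The Slater condition holds near `b` with a common point and a uniform margin. -/
theorem Slater.eventually_margin [TopologicalSpace T] [CompactSpace T]
    {g : T → EuclideanSpace ℝ (Fin n) → ℝ}
    (hgc : Continuous fun p : T × EuclideanSpace ℝ (Fin n) ↦ g p.1 p.2) {b : C(T, ℝ)}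
    (hs : Slater g b) :
    ∃ y, ∃ δ > 0, ∀ᶠ b' in 𝓝 b, ∀ t, g t y + δ ≤ b' t := by
  obtain ⟨y, hy⟩ := hs
  obtain ⟨δ, hδ, hδ'⟩ : ∃ δ > 0, ∀ t, g t y + δ ≤ b t := by
    rcases isEmpty_or_nonempty T with hT | hT
    · exact ⟨1, one_pos, fun t ↦ hT.elim t⟩
    · have hc : Continuous fun t ↦ b t - g t y :=
        b.continuous.sub (hgc.comp (continuous_id.prodMk continuous_const))
      obtain ⟨t₀, -, ht₀⟩ := (isCompact_univ (X := T)).exists_isMinOn univ_nonempty hc.continuousOn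
      refine ⟨b t₀ - g t₀ y, sub_pos.2 (hy t₀), fun t ↦ ?_⟩
      have : b t₀ - g t₀ y ≤ b t - g t y := ht₀ (mem_univ t)
      linarith
  refine ⟨y, δ / 2, half_pos hδ, ?_⟩
  filter_upwards [Metric.ball_mem_nhds b (half_pos hδ)] with b' hb' t
  have h1 := (ContinuousMap.dist_apply_le_dist (f := b') (g := b) t).trans_lt hb'
  rw [Real.dist_eq] at h1
  linarith [(abs_lt.1 h1).1, hδ' t]

/-- Under the Extended Nürnberger Condition, every solution near `xbar` of a problem with parameter
near `(cbar, bbar)` also solves the problem with unperturbed linear term `cbar`. -/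
theorem eventually_mem_partialArgmin [MetricSpace T] [CompactSpace T]
    {f : EuclideanSpace ℝ (Fin n) → ℝ} {g : T → EuclideanSpace ℝ (Fin n) → ℝ}
    (hf : ConvexOn ℝ univ f) (hg : ∀ t, ConvexOn ℝ univ (g t))
    (hgc : Continuous fun p : T × EuclideanSpace ℝ (Fin n) ↦ g p.1 p.2)
    {cbar : EuclideanSpace ℝ (Fin n)} {bbar : C(T, ℝ)} {xbar : EuclideanSpace ℝ (Fin n)}
    (hx : xbar ∈ argmin f g (cbar, bbar)) (hENC : ENC f g cbar bbar xbar) :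
    ∀ᶠ p : (EuclideanSpace ℝ (Fin n) × C(T, ℝ)) × EuclideanSpace ℝ (Fin n) in
      𝓝 ((cbar, bbar), xbar), p.2 ∈ argmin f g p.1 → p.2 ∈ partialArgmin f g cbar p.1.2 := by
  rcases Nat.eq_zero_or_pos n with rfl | hn
  · exact Eventually.of_forall fun p hp ↦ ⟨hp.1, fun y _ ↦ by rw [Subsingleton.elim y p.2]⟩
  -- Without constraints `-cbar` would be a subgradient of `f`, in conflict with `D = ∅`.
  rcases isEmpty_or_nonempty T with hT | hT
  · refine (hENC.2 ⟨∅, by simp, by simpa using hn, 0, ⟨-cbar, fun y ↦ ?_, by simp⟩,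
      Submodule.zero_mem _⟩).elim
    have := hx.2 y fun t ↦ hT.elim t
    simp only at this
    rw [inner_neg_left, inner_sub_right]
    linarith
  have hfc : Continuous f := hf.locallyLipschitz.continuous
  by_contra hbad
  have : (𝓝 ((cbar, bbar), xbar) ⊓ 𝓟 {p | ¬(p.2 ∈ argmin f g p.1 →
      p.2 ∈ partialArgmin f g cbar p.1.2)}).NeBot := frequently_iff_neBot.1 (not_eventually.1 hbad)
  obtain ⟨U, hUle⟩ := exists_ultrafilter_le (𝓝 ((cbar, bbar), xbar) ⊓
    𝓟 {p | ¬(p.2 ∈ argmin f g p.1 → p.2 ∈ partialArgmin f g cbar p.1.2)})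
  have hU : (U : Filter _) ≤ 𝓝 ((cbar, bbar), xbar) := hUle.trans inf_le_left
  have hUbad : ∀ᶠ p in (U : Filter ((EuclideanSpace ℝ (Fin n) × C(T, ℝ)) ×
      EuclideanSpace ℝ (Fin n))), p.2 ∈ argmin f g p.1 ∧ p.2 ∉ partialArgmin f g cbar p.1.2 :=
    Eventually.mono (le_principal_iff.1 (hUle.trans inf_le_right))
      fun p hp ↦ Classical.not_imp.1 hp
  have hpair : Tendsto (fun p : (EuclideanSpace ℝ (Fin n) × C(T, ℝ)) ×
      EuclideanSpace ℝ (Fin n) ↦ p) U (𝓝 ((cbar, bbar), xbar)) := hU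
  have hclim : Tendsto (fun p : (EuclideanSpace ℝ (Fin n) × C(T, ℝ)) ×
      EuclideanSpace ℝ (Fin n) ↦ p.1.1) U (𝓝 cbar) := hpair.fst_nhds.fst_nhds
  have hblim : Tendsto (fun p : (EuclideanSpace ℝ (Fin n) × C(T, ℝ)) ×
      EuclideanSpace ℝ (Fin n) ↦ p.1.2) U (𝓝 bbar) := hpair.fst_nhds.snd_nhds
  have hxlim : Tendsto (fun p : (EuclideanSpace ℝ (Fin n) × C(T, ℝ)) ×
      EuclideanSpace ℝ (Fin n) ↦ p.2) U (𝓝 xbar) := hpair.snd_nhds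
  obtain ⟨y, δ, hδ, hy⟩ := hENC.1.eventually_margin hgc
  have hmargin := hblim.eventually hy
  have hex : ∀ᶠ p in (U : Filter ((EuclideanSpace ℝ (Fin n) × C(T, ℝ)) ×
      EuclideanSpace ℝ (Fin n))), ∃ k : EuclideanSpace ℝ (Fin n) × (Fin n → T) ×
      (Fin n → EuclideanSpace ℝ (Fin n)) × (Fin n → ℝ),
      IsKKT f g p.1.1 p.1.2 p.2 k.1 k.2.1 k.2.2.1 k.2.2.2 := by
    filter_upwards [hUbad, hmargin] with p hp hyp
    obtain ⟨u, t, v, w, hk⟩ := exists_isKKT_of_mem_argmin hf hg hgc hp.1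
      ⟨y, fun t ↦ (lt_add_of_pos_right _ hδ).trans_le (hyp t)⟩
    exact ⟨(u, t, v, w), hk⟩
  obtain ⟨k, hk⟩ := hex.choice
  -- The objective gap to the Slater point bounds the multipliers.
  have hwbound : ∃ B, ∀ᶠ p in (U : Filter _), ∀ i, (k p).2.2.2 i ∈ Icc 0 B := by
    have hlim : Tendsto (fun p : (EuclideanSpace ℝ (Fin n) × C(T, ℝ)) ×
        EuclideanSpace ℝ (Fin n) ↦ f y + inner ℝ p.1.1 y - (f p.2 + inner ℝ p.1.1 p.2)) U
        (𝓝 (f y + inner ℝ cbar y - (f xbar + inner ℝ cbar xbar))) :=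
      (tendsto_const_nhds.add (hclim.inner tendsto_const_nhds)).sub
        (((hfc.tendsto xbar).comp hxlim).add (hclim.inner hxlim))
    refine ⟨(f y + inner ℝ cbar y - (f xbar + inner ℝ cbar xbar) + 1) / δ, ?_⟩
    filter_upwards [hk, hmargin, hlim.eventually_le_const (lt_add_one _)] with p hkp hyp hp i
    refine ⟨hkp.nonneg i, (le_div_iff₀ hδ).2 ?_⟩
    refine le_trans ?_ ((hkp.sum_mul_sub_le y).trans hp)
    refine le_trans ?_ (Finset.single_le_sum (fun j _ ↦ mul_nonneg (hkp.nonneg j) ?_)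
      (Finset.mem_univ i))
    · exact mul_le_mul_of_nonneg_left (by linarith [hyp ((k p).2.1 i)]) (hkp.nonneg i)
    · linarith [hyp ((k p).2.1 j)]
  obtain ⟨B, hB⟩ := hwbound
  obtain ⟨-, u₀, hu₀, -, hulim⟩ := exists_tendsto_subgradient (S := Unit) (h := fun _ ↦ f)
    (hfc.comp continuous_snd) U hxlim (s := fun _ ↦ ()) (v := fun p ↦ (k p).1)
    (hk.mono fun _ h ↦ h.objective)
  choose t₀ v₀ hv₀ htlim hvlim using fun i ↦ exists_tendsto_subgradient hgc U hxlim
    (s := fun p ↦ (k p).2.1 i) (v := fun p ↦ (k p).2.2.1 i) (hk.mono fun _ h ↦ h.constraint i)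
  choose w₀ hw₀ hwlim using fun i ↦ exists_tendsto_of_eventually_mem U
    (a := fun p ↦ (k p).2.2.2 i) isCompact_Icc (hB.mono fun _ h ↦ h i)
  have hk₀ : IsKKT f g cbar bbar xbar u₀ t₀ v₀ w₀ := by
    refine ⟨hu₀, hv₀, fun i ↦ (hw₀ i).1, fun i ↦ ?_, ?_⟩
    · have h1 := (hgc.tendsto (t₀ i, xbar)).comp ((htlim i).prodMk_nhds hxlim)
      have h2 := ((continuous_eval (F := C(T, ℝ))).tendsto (bbar, t₀ i)).comp
        (hblim.prodMk_nhds (htlim i))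
      exact tendsto_nhds_unique ((hwlim i).mul (h1.sub h2))
        (tendsto_const_nhds.congr' (hk.mono fun _ h ↦ (h.complementary i).symm))
    · refine tendsto_nhds_unique (tendsto_finsetSum _ fun i _ ↦ (hwlim i).smul (hvlim i)) ?_
      exact (hulim.add hclim).neg.congr' (hk.mono fun _ h ↦ h.stationary.symm)
  obtain ⟨hli, hpos⟩ := hk₀.linearIndependent_and_pos hENC
  obtain ⟨w, hw, hsum⟩ := exists_tendsto_coordinates (z := fun p ↦ -((k p).1 + cbar))
    (w₀ := w₀) hli hvlim (by
      rw [hk₀.stationary]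
      exact (hulim.add tendsto_const_nhds).neg)
  have hev : ∀ᶠ p in (U : Filter _), ∀ i, 0 < w p i ∧ 0 < (k p).2.2.2 i :=
    eventually_all.2 fun i ↦ ((tendsto_pi_nhds.1 hw i).eventually_const_lt (hpos i)).and
      ((hwlim i).eventually_const_lt (hpos i))
  obtain ⟨p, hkp, hsp, hwp, hp1, hp2⟩ := (hk.and (hsum.and (hev.and hUbad))).exists
  refine hp2 (IsKKT.mem_argmin (u := (k p).1) (t := (k p).2.1) (v := (k p).2.2.1) (w := w p)
    ⟨hkp.objective, hkp.constraint, fun i ↦ (hwp i).1.le, fun i ↦ ?_, hsp⟩ hp1.1)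
  -- The original multipliers are positive, so all the constraints involved are active.
  rw [(mul_eq_zero.1 (hkp.complementary i)).resolve_left (hwp i).2.ne', mul_zero]

end ConvexSIP

/-! ### Comparison of calmness moduli -/

theorem mainTheorem10 {n : ℕ} {T : Type*} [MetricSpace T] [CompactSpace T]
    (f : EuclideanSpace ℝ (Fin n) → ℝ) (g : T → EuclideanSpace ℝ (Fin n) → ℝ)
    (hf : ConvexOn ℝ Set.univ f) (hg : ∀ t, ConvexOn ℝ Set.univ (g t))
    (hgc : Continuous fun p : T × EuclideanSpace ℝ (Fin n) => g p.1 p.2)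
    (q : ℝ) (hq : 0 < q)
    (cbar : EuclideanSpace ℝ (Fin n)) (bbar : C(T, ℝ)) (xbar : EuclideanSpace ℝ (Fin n))
    (hx : xbar ∈ ConvexSIP.argmin f g (cbar, bbar))
    (hENC : ConvexSIP.ENC f g cbar bbar xbar) :
    calmnessModulus q (ConvexSIP.argmin f g) (cbar, bbar) xbar =
      calmnessModulus q (ConvexSIP.partialArgmin f g cbar) bbar xbar := by
  refine congrArg sSup (Set.ext fun s ↦ ⟨?_, ?_⟩)
  · rintro ⟨τ, hτ, rfl, U, hU, V, hV, h⟩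
    refine ⟨τ, hτ, rfl, U, hU, (fun b ↦ (cbar, b)) ⁻¹' V,
      (Continuous.prodMk_right cbar).continuousAt hV, fun b hb x hxb ↦ ?_⟩
    have hdist : edist (cbar, b) (cbar, bbar) = edist b bbar := by simp [Prod.edist_eq]
    exact hdist ▸ h (cbar, b) hb x hxb
  · rintro ⟨τ, hτ, rfl, U, hU, V, hV, h⟩
    obtain ⟨V', hV', U', hU', hsub⟩ := mem_nhds_prod_iff.1
      (ConvexSIP.eventually_mem_partialArgmin hf hg hgc hx hENC)
    refine ⟨τ, hτ, rfl, U ∩ U', inter_mem hU hU', V' ∩ Prod.snd ⁻¹' V,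
      inter_mem hV' (continuous_snd.continuousAt hV), fun p hp x hxp ↦ ?_⟩
    refine (h p.2 hp.2 x ⟨hsub (mk_mem_prod hp.1 hxp.2.2) hxp.1, hxp.2.1⟩).trans ?_
    exact ENNReal.rpow_le_rpow (le_max_right _ _) hq.le
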